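/- Let $\lambda\in\mathbb{Q}$. For a commutative semigroup $S$ let $\mathrm{Sh}_{\mathbb{Q},\lambda}(S)$ be the mixable shuffle algebra of weight $\lambda$ of the semigroup algebra $\mathbb{Q}S$: its underlying vector space is $\bigoplus_{n\ge 0}(\mathbb{Q}S)^{\otimes n}$, with basis the words $s_1\otimes\cdots\otimes s_n$ ($n\ge 0$, $s_i\in S$), the empty word is the unit, and the (commutative, associative) product is given on words recursively by $$(a\otimes u)*(b\otimes v)=a\otimes\bigl(u*(b\otimes v)\bigr)+b\otimes\bigl((a\otimes u)*v\bigr)+\lambda\,(ab)\otimes(u*v)\qquad(a,b\in S,\ u,v\text{ words}).$$ For a commutative monoid $S$ let $Ш_{\mathbb{Q},\lambda}(\mathbb{Q}S)=\mathbb{Q}S\otimes \mathrm{Sh}_{\mathbb{Q},\lambda}(S)$ (tensor product of $\mathbb{Q}$-algebras), with the linear operator $P(x_0\otimes x_1\otimes\cdots\otimes x_n)=1\otimes x_0\otimes x_1\otimes\cdots\otimes x_n$. If $S$ is totally ordered (no compatibility of the order with the product is required), words are compared lexicographically, a proper prefix being smaller, and a Lyndon word is a non-empty word $w$ such that $w<v$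 whenever $w=u\otimes v$ with $u,v$ non-empty; $\mathrm{Lyn}(S)$ is the set of Lyndon words. (1) Let $S$ be a totally ordered commutative monoid. Then $(Ш_{\mathbb{Q},\lambda}(\mathbb{Q}S),P)$, with $a\mapsto a\otimes 1$, is the free commutative Rota–Baxter $\mathbb{Q}$-algebra of weight $\lambda$ on the commutative algebra $\mathbb{Q}S$, and $$Ш_{\mathbb{Q},\lambda}(\mathbb{Q}S)=\mathbb{Q}S\otimes\mathbb{Q}[\mathrm{Lyn}(S)];$$ that is, the algebra homomorphism $\mathbb{Q}S\otimes\mathbb{Q}[\mathrm{Lyn}(S)]\to Ш_{\mathbb{Q},\lambda}(\mathbb{Q}S)$ which is the identity on $\mathbb{Q}S$ and sends the variable indexed by $w\in\mathrm{Lyn}(S)$ to $1\otimes w$ is an isomorphism. (2) Let $X$ be a set and let $M(X)$ be the free commutative monoid on $X$, endowed with any total order, so that $\mathbb{Q}[X]=\mathbb{Q}M(X)$. Then $(Ш_{\mathbb{Q},\lambda}(\mathbb{Q}[X]),P)$, with $x\mapsto x\otimes 1$ for $x\in X$, is the free commutative Rota–Baxter $\mathbb{Q}$-algebra of weight $\lambda$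 on $\mathbb{Q}[X]$, and $Ш_{\mathbb{Q},\lambda}(\mathbb{Q}[X])$ is the polynomial $\mathbb{Q}$-algebra on $X\cup\{1\otimes w : w\in\mathrm{Lyn}(M(X))\}$; that is, the algebra homomorphism from the polynomial algebra in variables indexed by the disjoint union $X\sqcup\mathrm{Lyn}(M(X))$ that sends $x\mapsto x\otimes 1$ and $w\mapsto 1\otimes w$ is an isomorphism. -/

import Mathlib

open scoped TensorProduct

universe u v w t

noncomputable section

namespace RotaBaxter

/-- The underlying module of the mixable shuffle algebra `Sh_{k,lam}(S)`: the free `k`-module on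
the words `s₁ ⊗ ⋯ ⊗ sₙ`, `n ≥ 0`, with letters in `S` (a word is a list). For `A = k S` this is
`⨁ₙ A^{⊗ n}`, written in its canonical basis. -/
def MixShuffle (k : Type u) [CommRing k] (_lam : k) (S : Type v) : Type (max u v) :=
  List S →₀ k

namespace MixShuffle

section Module

variable (k : Type u) [CommRing k] (lam : k) (S : Type v)

instance : AddCommGroup (MixShuffle k lam S) := inferInstanceAs (AddCommGroup (List S →₀ k))

instance : Module k (MixShuffle k lam S) := inferInstanceAs (Module k (List S →₀ k))

variable {S}

/-- The basis element of the mixable shuffle algebra given by a word. -/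
def word (u : List S) : MixShuffle k lam S := (Finsupp.single u 1 : List S →₀ k)

variable (S)

/-- The words form a basis. -/
def wordBasis : Module.Basis (List S) k (MixShuffle k lam S) :=
  (Finsupp.basisSingleOne : Module.Basis (List S) k (List S →₀ k))

variable {S}

theorem wordBasis_apply (u : List S) : wordBasis k lam S u = word k lam u := by
  change (Finsupp.basisSingleOne : Module.Basis (List S) k (List S →₀ k)) u = _
  simp [word]

/-- Prepending a letter: the linear map `u ↦ a ⊗ u`. -/
def consL (a : S) : MixShuffle k lam S →ₗ[k] MixShuffle k lam S :=
  (wordBasis k lam S).constr k fun u => word k lam (a :: u)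

@[simp]
theorem consL_word (a : S) (u : List S) : consL k lam a (word k lam u) = word k lam (a :: u) := by
  rw [consL, ← wordBasis_apply k lam u, Module.Basis.constr_basis]

variable {k lam}

theorem induction_word {p : MixShuffle k lam S → Prop} (hw : ∀ u, p (word k lam u))
    (hadd : ∀ x y, p x → p y → p (x + y)) (hsmul : ∀ (c : k) x, p x → p (c • x))
    (x : MixShuffle k lam S) : p x := by
  have hx : x ∈ Submodule.span k (Set.range (wordBasis k lam S)) := by
    rw [Module.Basis.span_eq]; trivial
  induction hx using Submodule.span_induction with
  | mem y hy =>
    obtain ⟨u, rfl⟩ := hy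
    rw [wordBasis_apply]
    exact hw u
  | zero => simpa using hsmul 0 _ (hw [])
  | add x y _ _ hx hy => exact hadd x y hx hy
  | smul c x _ hx => exact hsmul c x hx

end Module

section Product

variable (k : Type u) [CommRing k] (lam : k) {S : Type v} [CommSemigroup S]

/-- The mixable shuffle product of weight `lam` of two words. -/
def wordMul : List S → List S → MixShuffle k lam S
  | [], v => word k lam v
  | a :: u, [] => word k lam (a :: u)
  | a :: u, b :: v =>
      consL k lam a (wordMul u (b :: v)) + consL k lam b (wordMul (a :: u) v)
        + lam • consL k lam (a * b) (wordMul u v)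
  termination_by u v => u.length + v.length

/-- The mixable shuffle product of weight `lam`, extended bilinearly from words. -/
def mulL : MixShuffle k lam S →ₗ[k] MixShuffle k lam S →ₗ[k] MixShuffle k lam S :=
  (wordBasis k lam S).constr k fun u =>
    (wordBasis k lam S).constr k fun v => wordMul k lam u v

theorem mulL_word (u v : List S) :
    mulL k lam (word k lam u) (word k lam v) = wordMul k lam u v := by
  rw [mulL, ← wordBasis_apply k lam u, Module.Basis.constr_basis, ← wordBasis_apply k lam v,
    Module.Basis.constr_basis]

variable {k lam}

theorem nil_mulL (x : MixShuffle k lam S) : mulL k lam (word k lam []) x = x := by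
  induction x using induction_word with
  | hw u => rw [mulL_word, wordMul]
  | hadd x y hx hy => rw [map_add, hx, hy]
  | hsmul c x hx => rw [map_smul, hx]

theorem mulL_nil (x : MixShuffle k lam S) : mulL k lam x (word k lam []) = x := by
  induction x using induction_word with
  | hw u => rw [mulL_word]; cases u <;> rw [wordMul]
  | hadd x y hx hy => rw [map_add, LinearMap.add_apply, hx, hy]
  | hsmul c x hx => rw [map_smul, LinearMap.smul_apply, hx]

theorem consL_mulL_consL (a b : S) (x y : MixShuffle k lam S) :
    mulL k lam (consL k lam a x) (consL k lam b y)
      = consL k lam a (mulL k lam x (consL k lam b y))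
        + consL k lam b (mulL k lam (consL k lam a x) y)
        + lam • consL k lam (a * b) (mulL k lam x y) := by
  induction x using induction_word with
  | hw u =>
    induction y using induction_word with
    | hw v => simp only [consL_word, mulL_word]; rw [wordMul]
    | hadd x y hx hy => simp only [map_add, hx, hy, smul_add]; abel
    | hsmul c x hx => simp only [map_smul, hx, smul_add, smul_comm c lam]
  | hadd x y hx hy => simp only [map_add, LinearMap.add_apply, hx, hy, smul_add]; abel
  | hsmul c x hx => simp only [map_smul, LinearMap.smul_apply, hx, smul_add, smul_comm c lam]

theorem mulL_comm_word : ∀ (n : ℕ) (u v : List S), u.length + v.length ≤ n →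
    mulL k lam (word k lam u) (word k lam v) = mulL k lam (word k lam v) (word k lam u)
  | _, [], v, _ => by rw [nil_mulL, mulL_nil]
  | _, a :: u, [], _ => by rw [nil_mulL, mulL_nil]
  | 0, a :: u, b :: v, h => by simp at h
  | n + 1, a :: u, b :: v, h => by
    simp only [List.length_cons] at h
    have h1 := mulL_comm_word n u (b :: v) (by simp only [List.length_cons]; omega)
    have h2 := mulL_comm_word n (a :: u) v (by simp only [List.length_cons]; omega)
    have h3 := mulL_comm_word n u v (by omega)
    rw [← consL_word, ← consL_word, consL_mulL_consL, consL_mulL_consL, consL_word, consL_word,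
      h1, h2, h3, mul_comm b a]
    abel

theorem mulL_comm (x y : MixShuffle k lam S) : mulL k lam x y = mulL k lam y x := by
  induction x using induction_word with
  | hw u =>
    induction y using induction_word with
    | hw v => exact mulL_comm_word _ u v le_rfl
    | hadd x y hx hy => simp only [map_add, LinearMap.add_apply, hx, hy]
    | hsmul c x hx => simp only [map_smul, LinearMap.smul_apply, hx]
  | hadd x y hx hy => simp only [map_add, LinearMap.add_apply, hx, hy]
  | hsmul c x hx => simp only [map_smul, LinearMap.smul_apply, hx]

theorem mulL_assoc_word : ∀ (n : ℕ) (u v t : List S), u.length + v.length + t.length ≤ n →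
    mulL k lam (mulL k lam (word k lam u) (word k lam v)) (word k lam t)
      = mulL k lam (word k lam u) (mulL k lam (word k lam v) (word k lam t))
  | _, [], v, t, _ => by rw [nil_mulL, nil_mulL]
  | _, a :: u, [], t, _ => by rw [nil_mulL, mulL_nil]
  | _, a :: u, b :: v, [], _ => by rw [mulL_nil, mulL_nil]
  | 0, a :: u, b :: v, c :: t, h => by simp at h
  | n + 1, a :: u, b :: v, c :: t, h => by
    simp only [List.length_cons] at h
    have e1 := mulL_assoc_word n u (b :: v) (c :: t) (by simp only [List.length_cons]; omega)
    have e2 := mulL_assoc_word n (a :: u) v (c :: t) (by simp only [List.length_cons]; omega)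
    have e3 := mulL_assoc_word n (a :: u) (b :: v) t (by simp only [List.length_cons]; omega)
    have e4 := mulL_assoc_word n u v (c :: t) (by simp only [List.length_cons]; omega)
    have e5 := mulL_assoc_word n u (b :: v) t (by simp only [List.length_cons]; omega)
    have e6 := mulL_assoc_word n (a :: u) v t (by simp only [List.length_cons]; omega)
    have e7 := mulL_assoc_word n u v t (by omega)
    simp only [← consL_word] at e1 e2 e3 e4 e5 e6 ⊢
    -- expand only the inner product of `b v` and `c t` in `e1`, of `a u` and `b v` in `e3`
    rw [consL_mulL_consL b c] at e1
    rw [consL_mulL_consL a b] at e3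
    simp only [map_add, map_smul, LinearMap.add_apply, LinearMap.smul_apply] at e1 e3
    rw [consL_mulL_consL a b, consL_mulL_consL b c]
    simp only [map_add, map_smul, LinearMap.add_apply, LinearMap.smul_apply, consL_mulL_consL a,
      consL_mulL_consL b, consL_mulL_consL (a * b), smul_add]
    rw [e1, ← e3]
    simp only [map_add, map_smul, e2, e4, e5, e6, e7, mul_assoc]
    abel

theorem mulL_assoc (x y z : MixShuffle k lam S) :
    mulL k lam (mulL k lam x y) z = mulL k lam x (mulL k lam y z) := by
  induction x using induction_word with
  | hw u =>
    induction y using induction_word with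
    | hw v =>
      induction z using induction_word with
      | hw t => exact mulL_assoc_word _ u v t le_rfl
      | hadd x y hx hy => simp only [map_add, hx, hy]
      | hsmul c x hx => simp only [map_smul, hx]
    | hadd x y hx hy => simp only [map_add, LinearMap.add_apply, hx, hy]
    | hsmul c x hx => simp only [map_smul, LinearMap.smul_apply, hx]
  | hadd x y hx hy => simp only [map_add, LinearMap.add_apply, hx, hy]
  | hsmul c x hx => simp only [map_smul, LinearMap.smul_apply, hx]

/-- The mixable shuffle algebra is a commutative ring; its unit is the empty word. -/
instance : CommRing (MixShuffle k lam S) :=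
  { (inferInstance : AddCommGroup (MixShuffle k lam S)) with
    mul := fun x y => mulL k lam x y
    one := word k lam []
    left_distrib := fun x y z => map_add (mulL k lam x) y z
    right_distrib := fun x y z => by
      change mulL k lam (x + y) z = mulL k lam x z + mulL k lam y z
      rw [map_add, LinearMap.add_apply]
    zero_mul := fun x => by
      change mulL k lam 0 x = 0
      rw [map_zero, LinearMap.zero_apply]
    mul_zero := fun x => map_zero (mulL k lam x)
    mul_assoc := mulL_assoc
    one_mul := nil_mulL
    mul_one := mulL_nil
    mul_comm := mulL_comm }

theorem mul_def (x y : MixShuffle k lam S) : x * y = mulL k lam x y := rfl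

theorem one_def : (1 : MixShuffle k lam S) = word k lam [] := rfl

instance : Algebra k (MixShuffle k lam S) :=
  Algebra.ofModule (fun r x y => by rw [mul_def, mul_def, map_smul, LinearMap.smul_apply])
    (fun r x y => by rw [mul_def, mul_def, map_smul])

end Product

end MixShuffle

section RotaBaxterAlgebra

/-- `P` is a Rota--Baxter operator of weight `lam` on the `k`-algebra `R`. -/
def IsRotaBaxter {k : Type u} [CommRing k] (lam : k) {R : Type v} [CommRing R] [Algebra k R]
    (P : R →ₗ[k] R) : Prop :=
  ∀ x y : R, P x * P y = P (x * P y) + P (P x * y) + lam • P (x * y)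

/-- `(F, P)` together with `j : A → F` is a free commutative Rota--Baxter algebra of weight `lam`
on the commutative algebra `A`. The universal property is tested against all commutative
Rota--Baxter algebras in the universe `w`. -/
def IsFreeCommRotaBaxter {k : Type u} [CommRing k] (lam : k) {A : Type v} [CommRing A]
    [Algebra k A] {F : Type t} [CommRing F] [Algebra k F] (P : F →ₗ[k] F) (j : A →ₐ[k] F) : Prop :=
  IsRotaBaxter lam P ∧
    ∀ (R : Type w) [CommRing R] [Algebra k R] (Q : R →ₗ[k] R), IsRotaBaxter lam Q →
      ∀ φ : A →ₐ[k] R, ∃! ψ : F →ₐ[k] R, (∀ x, ψ (P x) = Q (ψ x)) ∧ ∀ a, ψ (j a) = φ a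

end RotaBaxterAlgebra

section Sha

variable (k : Type u) [CommRing k] (lam : k) (S : Type v) [CommMonoid S]

/-- The algebra `Ш_{k,lam}(k S) = k S ⊗ Sh_{k,lam}(S)`, with the product of a tensor product of
algebras. -/
abbrev Sha : Type (max u v) := MonoidAlgebra k S ⊗[k] MixShuffle k lam S

namespace Sha

/-- The canonical inclusion `k S → Ш_{k,lam}(k S)`, `a ↦ a ⊗ 1`. -/
def incl : MonoidAlgebra k S →ₐ[k] Sha k lam S :=
  Algebra.TensorProduct.includeLeft

/-- Prepending an element of `k S`: the bilinear map `(a, u) ↦ a ⊗ u`, a tensor of length one more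
than `u`. -/
def prepend : MonoidAlgebra k S →ₗ[k] MixShuffle k lam S →ₗ[k] MixShuffle k lam S :=
  (Finsupp.lift (MixShuffle k lam S →ₗ[k] MixShuffle k lam S) k S
      fun s => MixShuffle.consL k lam s) ∘ₗ
    (MonoidAlgebra.coeffLinearEquiv k : MonoidAlgebra k S ≃ₗ[k] (S →₀ k)).toLinearMap

/-- The Rota--Baxter operator `x₀ ⊗ x₁ ⊗ ⋯ ⊗ xₙ ↦ 1 ⊗ x₀ ⊗ x₁ ⊗ ⋯ ⊗ xₙ`. -/
def rbOp : Sha k lam S →ₗ[k] Sha k lam S :=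
  (TensorProduct.mk k (MonoidAlgebra k S) (MixShuffle k lam S) 1) ∘ₗ
    TensorProduct.lift (prepend k lam S)

end Sha

end Sha

section Lyndon

/-- A Lyndon word over an ordered set: a non-empty word that is lexicographically smaller than each
of its proper non-empty right factors. -/
def IsLyndon {S : Type u} [LinearOrder S] (t : List S) : Prop :=
  t ≠ [] ∧ ∀ x y : List S, x ≠ [] → y ≠ [] → t = x ++ y → List.Lex (· < ·) t y

/-- The set `Lyn(S)` of Lyndon words. -/
abbrev Lyn (S : Type u) [LinearOrder S] : Type u := {t : List S // IsLyndon t}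

end Lyndon

section Maps

variable (k : Type u) [CommRing k] (lam : k)

/-- The canonical algebra map `k[Lyn(S)] → Sh_{k,lam}(S)`: the variable of a Lyndon word goes to
that word. -/
def lynMap (S : Type v) [CommSemigroup S] [LinearOrder S] :
    MvPolynomial (Lyn S) k →ₐ[k] MixShuffle k lam S :=
  MvPolynomial.aeval fun t : Lyn S => MixShuffle.word k lam t.1

/-- The canonical algebra map `k S ⊗ k[Lyn(S)] → k S ⊗ Sh_{k,lam}(S) = Ш_{k,lam}(k S)`. -/
def tensorLynMap (S : Type v) [CommMonoid S] [LinearOrder S] :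
    MonoidAlgebra k S ⊗[k] MvPolynomial (Lyn S) k →ₐ[k] Sha k lam S :=
  Algebra.TensorProduct.map (AlgHom.id k (MonoidAlgebra k S)) (lynMap k lam S)

/-- The free commutative monoid on `X`, written multiplicatively: the monomials in the variables
`X`. It carries no order. -/
def FreeCommMon (X : Type v) : Type v := Multiplicative (X →₀ ℕ)

instance (X : Type v) : CommMonoid (FreeCommMon X) :=
  inferInstanceAs (CommMonoid (Multiplicative (X →₀ ℕ)))

/-- The generator of the free commutative monoid given by `x`. -/
def FreeCommMon.of {X : Type v} (x : X) : FreeCommMon X :=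
  Multiplicative.ofAdd (Finsupp.single x 1)

/-- The element `x ⊗ 1` of `Ш_{k,lam}(k[X])`, where `k[X]` is the monoid algebra of the free
commutative monoid on `X`. -/
def varElt {X : Type v} (x : X) : Sha k lam (FreeCommMon X) :=
  Sha.incl k lam (FreeCommMon X) (MonoidAlgebra.of k (FreeCommMon X) (FreeCommMon.of x))

/-- The canonical map `k[X] → Ш_{k,lam}(k[X])`, `x ↦ x ⊗ 1`. -/
def polyIncl (X : Type v) : MvPolynomial X k →ₐ[k] Sha k lam (FreeCommMon X) :=
  MvPolynomial.aeval (varElt k lam)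

/-- The family `X ∪ {1 ⊗ t | t ∈ Lyn(M(X))}` of elements of `Ш_{k,lam}(k[X])`. -/
def lynBar (X : Type v) [LinearOrder (FreeCommMon X)] :
    X ⊕ Lyn (FreeCommMon X) → Sha k lam (FreeCommMon X) :=
  Sum.elim (varElt k lam) fun t => 1 ⊗ₜ[k] MixShuffle.word k lam t.1

end Maps

end RotaBaxter

end

/-!
Over a field of characteristic zero, the mixable shuffle algebra of any weight is the polynomial
algebra on the Lyndon words, by a triangularity argument.

The words occurring in `wordMul u v` are the shuffles of `u` and `v`, whose coefficients are natural
numbers, and words of smaller length, which absorb everything coming from the weight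
(`MixShuffle.length_lt_or_isShuffle`, `MixShuffle.exists_coeff_wordMul_eq_natCast`). If no non-empty
right factor of `w` is smaller than `v`, the lexicographically largest shuffle of `w` and `v` is
`w ++ v` (`IsShuffle.le_append`). The proof is by induction on `w`; when the shuffle takes the first
letter of `v` although `w` begins with the same letter, that letter has to be moved from one word to
the other, which `IsShuffle.exists_le_of_move_prefix` permits. The hypothesis holds when `w` is a
product of Lyndon words none of which is smaller than `v` (`le_of_suffix_concat`). So the product of
a non-increasing sequence of Lyndon words has their concatenation as leading word
(`hasLeadingWord_prod`), with respect to the relation `Precedes`: shorter, or a lexicographically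
smaller rearrangement. This relation is well-founded although the alphabet need not be.

Every word is in exactly one way the concatenation of a non-increasing sequence of Lyndon words
(`exists_concat_eq`, `eq_of_concat_eq`). Hence the monomials in the Lyndon words have pairwise
distinct leading words, and every word is one of them, so that they form a basis
(`bijective_lynMap`). Tensoring with the monoid algebra gives the polynomial descriptions.

For the universal property (`Sha.isFreeCommRotaBaxter`), the extension of `φ` is
`x₀ ⊗ x₁ ⊗ ⋯ ⊗ xₙ ↦ φ x₀ * Q (φ x₁ * Q (φ x₂ * ⋯ Q (φ xₙ)))`. The recursion defining the mixable
shuffle product is the Rota--Baxter identity, so this map is multiplicative (`evalL_wordMul`).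
-/

noncomputable section

namespace RotaBaxter

/-! ### Shuffles of words -/

section Shuffle

variable {S : Type u}

/-- `IsShuffle u v x` says that the word `x` is a shuffle of `u` and `v`: its letters can be split
into two complementary subsequences spelling `u` and `v`. -/
inductive IsShuffle : List S → List S → List S → Prop
  | nil : IsShuffle [] [] []
  | left (a : S) {u v x : List S} : IsShuffle u v x → IsShuffle (a :: u) v (a :: x)
  | right (b : S) {u v x : List S} : IsShuffle u v x → IsShuffle u (b :: v) (b :: x)

namespace IsShuffle

theorem nil_left : ∀ v : List S, IsShuffle [] v v
  | [] => nil
  | b :: v => (nil_left v).right b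

theorem append : ∀ u v : List S, IsShuffle u v (u ++ v)
  | [], v => nil_left v
  | a :: u, v => (append u v).left a

theorem perm {u v x : List S} (h : IsShuffle u v x) : x.Perm (u ++ v) := by
  induction h with
  | nil => exact .refl _
  | left a _ ih => exact ih.cons a
  | right b _ ih => exact (ih.cons b).trans List.perm_middle.symm

theorem length_eq {u v x : List S} (h : IsShuffle u v x) : x.length = u.length + v.length := by
  simpa using h.perm.length_eq

theorem eq_of_nil_left {v x : List S} (h : IsShuffle [] v x) : x = v := by
  induction v generalizing x with
  | nil => cases h; rfl
  | cons b v ih =>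
    cases h with
    | right _ h => rw [ih h]

variable [LinearOrder S]

/-- Replacing `u` by a larger word of the same length in a given shuffle pattern makes the shuffle
larger. -/
theorem exists_lt_of_lt {u u' v x : List S} (h : IsShuffle u v x) (hl : u.length = u'.length)
    (hu : u < u') : ∃ x', IsShuffle u' v x' ∧ x < x' := by
  induction h generalizing u' with
  | nil => cases u' with
    | nil => exact absurd hu (lt_irrefl _)
    | cons => simp at hl
  | left a _ ih => cases u' with
    | nil => simp at hl
    | cons b u' =>
      rcases List.cons_lt_cons_iff.1 hu with hab | ⟨rfl, huu⟩
      · exact ⟨_, append _ _, List.cons_lt_cons_iff.2 (.inl hab)⟩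
      · obtain ⟨x', hx', hlt⟩ := ih (by simpa using hl) huu
        exact ⟨_, hx'.left a, List.cons_lt_cons_iff.2 (.inr ⟨rfl, hlt⟩)⟩
  | right b _ ih =>
    obtain ⟨x', hx', hlt⟩ := ih hl hu
    exact ⟨_, hx'.right b, List.cons_lt_cons_iff.2 (.inr ⟨rfl, hlt⟩)⟩

end IsShuffle

variable [LinearOrder S]

theorem cons_le_cons_iff_lex {a b : S} {u v : List S} :
    a :: u ≤ b :: v ↔ a < b ∨ a = b ∧ u ≤ v := by
  rw [← not_lt, List.cons_lt_cons_iff, ← not_lt (a := v)]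
  rcases lt_trichotomy a b with h | rfl | h
  · simp [h, h.not_gt, h.ne']
  · simp
  · simp [h, h.not_gt, h.ne']

theorem nil_le_word (u : List S) : ([] : List S) ≤ u := not_lt.1 (List.not_lt_nil u)

theorem append_le_append_iff_left {p u v : List S} : p ++ u ≤ p ++ v ↔ u ≤ v := by
  induction p with
  | nil => rfl
  | cons a p ih => simp [cons_le_cons_iff_lex, ih]

theorem le_append_word (u v : List S) : u ≤ u ++ v := by
  simpa using (append_le_append_iff_left (p := u)).2 (nil_le_word v)

/-- Moving a prefix `p` from the larger of two words to the smaller one does not decrease the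
largest shuffle. -/
theorem IsShuffle.exists_le_of_move_prefix {p u v x : List S} (huv : v ≤ u)
    (h : IsShuffle (p ++ u) v x) : ∃ y, IsShuffle u (p ++ v) y ∧ x ≤ y := by
  induction x generalizing p u v with
  | nil =>
    have := h.length_eq
    obtain ⟨rfl, rfl, rfl⟩ : p = [] ∧ u = [] ∧ v = [] := by
      simp only [List.length_nil, List.length_append] at this
      refine ⟨?_, ?_, ?_⟩ <;> apply List.length_eq_zero_iff.1 <;> omega
    exact ⟨[], .nil, le_rfl⟩
  | cons c x ih =>
    obtain _ | ⟨a, p⟩ := p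
    · exact ⟨_, h, le_rfl⟩
    · cases h with
      | left _ h =>
        obtain ⟨y, hy, hxy⟩ := ih huv h
        exact ⟨_, hy.right _, cons_le_cons_iff_lex.2 (.inr ⟨rfl, hxy⟩)⟩
      | @right _ _ v' _ h =>
        obtain _ | ⟨d, u⟩ := u
        · exact absurd huv (not_le.2 (List.nil_lt_cons _ _))
        · rcases cons_le_cons_iff_lex.1 huv with hcd | ⟨rfl, hvu⟩
          · exact ⟨_, append _ _, cons_le_cons_iff_lex.2 (.inl hcd)⟩
          · -- The common first letter joins the prefix that is being moved.
            obtain ⟨y, hy, hxy⟩ := ih (p := a :: p ++ [c]) hvu (by simpa using h)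
            exact ⟨_, (by simpa using hy : IsShuffle u (a :: p ++ c :: v') y).left c,
              cons_le_cons_iff_lex.2 (.inr ⟨rfl, hxy⟩)⟩

/-- If no non-empty right factor of `w` is smaller than `v`, the concatenation `w ++ v` is the
largest shuffle of `w` and `v`. -/
theorem IsShuffle.le_append {w v x : List S} (hw : ∀ s, s ≠ [] → s <:+ w → v ≤ s)
    (h : IsShuffle w v x) : x ≤ w ++ v := by
  induction w generalizing x with
  | nil => exact h.eq_of_nil_left.le
  | cons a w ih =>
    have hw' : ∀ s, s ≠ [] → s <:+ w → v ≤ s := fun s hs h =>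
      hw s hs (h.trans (List.suffix_cons a w))
    have hv := hw (a :: w) (by simp) List.suffix_rfl
    cases h with
    | left _ h => exact cons_le_cons_iff_lex.2 (.inr ⟨rfl, ih hw' h⟩)
    | right b h =>
      rcases cons_le_cons_iff_lex.1 hv with hba | ⟨rfl, hvw⟩
      · exact cons_le_cons_iff_lex.2 (.inl hba)
      · obtain ⟨y, hy, hxy⟩ := IsShuffle.exists_le_of_move_prefix (p := [b]) hvw h
        exact cons_le_cons_iff_lex.2 (.inr ⟨rfl, hxy.trans (ih hw' hy)⟩)

end Shuffle

/-! ### Factorization of words into Lyndon words -/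

section Factorization

variable {S : Type u} [LinearOrder S]

theorem IsLyndon.le_of_suffix {l s : List S} (hl : IsLyndon l) (hs : s ≠ []) (h : s <:+ l) :
    l ≤ s := by
  obtain ⟨x, rfl⟩ := h
  by_cases hx : x = []
  · simp [hx]
  · exact le_of_lt (show x ++ s < s from hl.2 x s hx hs rfl)

theorem append_lt_or_exists_of_lt {m l : List S} (h : m < l) :
    (∀ s, m ++ s < l) ∨ ∃ t, t ≠ [] ∧ l = m ++ t := by
  induction m generalizing l with
  | nil => exact .inr ⟨l, by rintro rfl; exact lt_irrefl _ h, rfl⟩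
  | cons a m ih => cases l with
    | nil => exact absurd h (List.not_lt_nil _)
    | cons b l =>
      rcases List.cons_lt_cons_iff.1 h with hab | ⟨rfl, hml⟩
      · exact .inl fun s => List.cons_lt_cons_iff.2 (.inl hab)
      · rcases ih hml with h | ⟨t, ht, rfl⟩
        · exact .inl fun s => List.cons_lt_cons_iff.2 (.inr ⟨rfl, h s⟩)
        · exact .inr ⟨t, ht, rfl⟩

/-- The concatenation of a list of Lyndon words. -/
def concat (L : List (Lyn S)) : List S := (L.map Subtype.val).flatten

@[simp]
theorem concat_nil : concat ([] : List (Lyn S)) = [] := rfl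

@[simp]
theorem concat_cons (l : Lyn S) (L : List (Lyn S)) : concat (l :: L) = l.1 ++ concat L := rfl

@[simp]
theorem concat_append (L M : List (Lyn S)) : concat (L ++ M) = concat L ++ concat M := by
  simp [concat]

theorem le_of_suffix_concat {v : List S} {L : List (Lyn S)} (hL : ∀ l ∈ L, v ≤ l.1) {s : List S}
    (hs : s ≠ []) (h : s <:+ concat L) : v ≤ s := by
  induction L generalizing s with
  | nil => exact absurd (List.suffix_nil.1 h) hs
  | cons l L ih =>
    have ih := ih (fun m hm => hL m (List.mem_cons_of_mem _ hm)) hs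
    by_cases hlen : s.length ≤ (concat L).length
    · exact ih (List.suffix_of_suffix_length_le h (List.suffix_append _ _) hlen)
    · obtain ⟨s', rfl⟩ := List.suffix_of_suffix_length_le
        (List.suffix_append l.1 (concat L)) h (by omega)
      have hs' : s' ≠ [] := by rintro rfl; simp at hlen
      have hsl : s' <:+ l.1 := by
        obtain ⟨r, hr⟩ := h
        rw [concat_cons, ← List.append_assoc] at hr
        exact ⟨r, List.append_cancel_right hr⟩
      exact (hL l (by simp)).trans ((l.2.le_of_suffix hs' hsl).trans (le_append_word _ _))

theorem exists_min_suffix {w : List S} (hw : w ≠ []) :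
    ∃ l, l ≠ [] ∧ l <:+ w ∧ ∀ s, s ≠ [] → s <:+ w → l ≤ s := by
  obtain ⟨l, hl, hmin⟩ := Finset.exists_min_image (w.tails.toFinset.filter (· ≠ [])) id
    ⟨w, by simp [hw]⟩
  simp only [Finset.mem_filter, List.mem_toFinset, List.mem_tails, id] at hl hmin
  exact ⟨l, hl.2, hl.1, fun s hs h => hmin s ⟨h, hs⟩⟩

/-- Every word is a concatenation of a non-increasing sequence of Lyndon words. The last factor is
the smallest non-empty right factor. -/
theorem exists_concat_eq (w : List S) :
    ∃ L : List (Lyn S), L.Pairwise (· ≥ ·) ∧ concat L = w := by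
  induction hn : w.length using Nat.strong_induction_on generalizing w with
  | _ n ih =>
  subst hn
  by_cases hw : w = []
  · exact ⟨[], .nil, hw.symm⟩
  obtain ⟨l, hl, ⟨w', rfl⟩, hmin⟩ := exists_min_suffix hw
  have hlyn : IsLyndon l := by
    refine ⟨hl, fun x y hx hy hxy => ?_⟩
    refine lt_of_le_of_ne (hmin y hy ?_) fun h => hx ?_
    · rw [hxy, ← List.append_assoc]; exact List.suffix_append _ _
    · rw [h] at hxy; simpa using hxy
  obtain ⟨L, hL, rfl⟩ := ih w'.length (by simpa [List.length_pos_iff] using hl) w' rfl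
  refine ⟨L ++ [⟨l, hlyn⟩], ?_, by simp⟩
  rw [List.pairwise_append]
  refine ⟨hL, List.pairwise_singleton _ _, ?_⟩
  suffices h : ∀ m ∈ L, l ≤ m.1 by
    intro a ha b hb
    obtain rfl := List.mem_singleton.1 hb
    exact h a ha
  obtain rfl | ⟨L, m, rfl⟩ := L.eq_nil_or_concat'
  · simp
  have hlm : l ≤ m.1 := by
    by_contra hlt
    have hml : l ≤ m.1 ++ l := hmin _ (by simp [hl]) (by simp)
    rcases append_lt_or_exists_of_lt (not_le.1 hlt) with h | ⟨t, ht, rfl⟩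
    · exact absurd hml (not_le.2 (h l))
    · exact absurd (append_le_append_iff_left.1 hml)
        (not_le.2 (hlyn.2 m.1 t m.2.1 ht rfl))
  intro a ha
  rcases List.mem_append.1 ha with ha | ha
  · exact hlm.trans ((List.pairwise_append.1 hL).2.2 a ha m (by simp))
  · obtain rfl := List.mem_singleton.1 ha
    exact hlm

/-- A non-increasing factorization into Lyndon words is unique: its last factor is the smallest
non-empty right factor of the word. -/
theorem eq_of_concat_eq {L M : List (Lyn S)} (hL : L.Pairwise (· ≥ ·)) (hM : M.Pairwise (· ≥ ·))
    (h : concat L = concat M) : L = M := by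
  have key : ∀ (L M : List (Lyn S)) (l m : Lyn S), (L ++ [l]).Pairwise (· ≥ ·) →
      concat (L ++ [l]) = concat (M ++ [m]) → l.1 ≤ m.1 := by
    intro L M l m hL h
    refine le_of_suffix_concat (L := L ++ [l]) (fun a ha => ?_) m.2.1 ?_
    · rcases List.mem_append.1 ha with ha | ha
      · exact (List.pairwise_append.1 hL).2.2 a ha l (by simp)
      · rw [List.mem_singleton.1 ha]
    · rw [h, concat_append]; simp
  induction L using List.reverseRecOn generalizing M with
  | nil =>
    cases M with
    | nil => rfl
    | cons m M => simp [m.2.1] at h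
  | append_singleton L l ih =>
    obtain rfl | ⟨M, m, rfl⟩ := M.eq_nil_or_concat'
    · simp [l.2.1] at h
    · obtain rfl : l = m := Subtype.ext (le_antisymm (key L M l m hL h) (key M L m l hM h.symm))
      rw [ih (List.pairwise_append.1 hL).1 (List.pairwise_append.1 hM).1 (by simpa using h)]

end Factorization

/-! ### Leading words in the mixable shuffle algebra -/

section Coefficients

variable {k : Type u} [CommRing k] {lam : k} {S : Type v}

namespace MixShuffle

/-- The coefficient of a word in an element of the mixable shuffle algebra. -/
def coeff (x : List S) : MixShuffle k lam S →ₗ[k] k := (wordBasis k lam S).coord x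

theorem coeff_word_self (u : List S) : coeff u (word k lam u) = 1 := by
  simp [coeff, ← wordBasis_apply]

theorem coeff_word_of_ne {x u : List S} (h : u ≠ x) : coeff x (word k lam u) = 0 := by
  simp [coeff, ← wordBasis_apply, h]

theorem coeff_nil_consL (a : S) (p : MixShuffle k lam S) : coeff [] (consL k lam a p) = 0 := by
  induction p using induction_word with
  | hw u => rw [consL_word, coeff_word_of_ne (by simp)]
  | hadd x y hx hy => rw [map_add, map_add, hx, hy, add_zero]
  | hsmul c x hx => rw [map_smul, map_smul, hx, smul_zero]

theorem coeff_cons_consL_self (a : S) (x : List S) (p : MixShuffle k lam S) :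
    coeff (a :: x) (consL k lam a p) = coeff x p := by
  induction p using induction_word with
  | hw u =>
    rw [consL_word]
    by_cases h : u = x
    · subst h; rw [coeff_word_self, coeff_word_self]
    · rw [coeff_word_of_ne h, coeff_word_of_ne (by simpa using h)]
  | hadd x y hx hy => rw [map_add, map_add, map_add, hx, hy]
  | hsmul c x hx => rw [map_smul, map_smul, map_smul, hx]

theorem coeff_cons_consL_of_ne {a b : S} (h : a ≠ b) (x : List S) (p : MixShuffle k lam S) :
    coeff (b :: x) (consL k lam a p) = 0 := by
  induction p using induction_word with
  | hw u => rw [consL_word, coeff_word_of_ne (by simp [h])]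
  | hadd x y hx hy => rw [map_add, map_add, hx, hy, add_zero]
  | hsmul c x hx => rw [map_smul, map_smul, hx, smul_zero]

theorem exists_of_coeff_consL_ne_zero {a : S} {x : List S} {p : MixShuffle k lam S}
    (h : coeff x (consL k lam a p) ≠ 0) : ∃ x', x = a :: x' ∧ coeff x' p ≠ 0 := by
  obtain _ | ⟨b, x⟩ := x
  · exact absurd (coeff_nil_consL a p) h
  · by_cases hab : a = b
    · subst hab
      exact ⟨x, rfl, by rwa [coeff_cons_consL_self] at h⟩
    · exact absurd (coeff_cons_consL_of_ne hab x p) h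

theorem sum_coeff_smul_word (p : MixShuffle k lam S) :
    ∑ u ∈ ((wordBasis k lam S).repr p).support, coeff u p • word k lam u = p := by
  conv_rhs => rw [← (wordBasis k lam S).linearCombination_repr p, Finsupp.linearCombination_apply]
  simp [Finsupp.sum, coeff, wordBasis_apply]

theorem mem_support_repr {u : List S} {p : MixShuffle k lam S} :
    u ∈ ((wordBasis k lam S).repr p).support ↔ coeff u p ≠ 0 := by
  simp [coeff]

variable [CommSemigroup S]

/-- The words of a mixable shuffle product are the shuffles and strictly shorter words. -/
theorem length_lt_or_isShuffle {u v x : List S} (h : coeff x (wordMul k lam u v) ≠ 0) :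
    x.length < u.length + v.length ∨ IsShuffle u v x := by
  induction u, v using wordMul.induct generalizing x with
  | case1 v =>
    rw [wordMul] at h
    obtain rfl : v = x := by_contra fun hne => h (coeff_word_of_ne hne)
    exact .inr (.nil_left v)
  | case2 a u =>
    rw [wordMul] at h
    obtain rfl : a :: u = x := by_contra fun hne => h (coeff_word_of_ne hne)
    exact .inr (by simpa using IsShuffle.append (a :: u) [])
  | case3 a u b v ih₁ ih₂ ih₃ =>
    rw [wordMul, map_add, map_add, map_smul] at h
    simp only [List.length_cons] at ih₁ ih₂ ⊢
    by_cases h1 : coeff x (consL k lam a (wordMul k lam u (b :: v))) = 0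
    · by_cases h2 : coeff x (consL k lam b (wordMul k lam (a :: u) v)) = 0
      · rw [h1, h2, zero_add, zero_add] at h
        obtain ⟨x', rfl, hx'⟩ := exists_of_coeff_consL_ne_zero (right_ne_zero_of_smul h)
        left
        rcases ih₃ hx' with h' | h'
        · simp only [List.length_cons]; omega
        · have := h'.length_eq
          simp only [List.length_cons]; omega
      · obtain ⟨x', rfl, hx'⟩ := exists_of_coeff_consL_ne_zero h2
        rcases ih₂ hx' with h' | h'
        · left; simp only [List.length_cons]; omega
        · exact .inr (h'.right b)
    · obtain ⟨x', rfl, hx'⟩ := exists_of_coeff_consL_ne_zero h1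
      rcases ih₁ hx' with h' | h'
      · left; simp only [List.length_cons]; omega
      · exact .inr (h'.left a)

/-- In top length the coefficients of a mixable shuffle product count shuffles: they are natural
numbers, and the concatenation occurs. -/
theorem exists_coeff_wordMul_eq_natCast {u v x : List S} (h : x.length = u.length + v.length) :
    ∃ n : ℕ, coeff x (wordMul k lam u v) = n ∧ (x = u ++ v → 0 < n) := by
  induction u, v using wordMul.induct generalizing x with
  | case1 v =>
    rw [wordMul]
    by_cases hx : v = x
    · subst hx; exact ⟨1, by rw [coeff_word_self, Nat.cast_one], by simp⟩
    · exact ⟨0, by rw [coeff_word_of_ne hx, Nat.cast_zero], fun h => absurd h.symm hx⟩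
  | case2 a u =>
    rw [wordMul]
    by_cases hx : a :: u = x
    · subst hx; exact ⟨1, by rw [coeff_word_self, Nat.cast_one], by simp⟩
    · exact ⟨0, by rw [coeff_word_of_ne hx, Nat.cast_zero],
        fun h => absurd (by simpa using h.symm) hx⟩
  | case3 a u b v ih₁ ih₂ ih₃ =>
    obtain _ | ⟨c, x⟩ := x
    · simp at h
    simp only [List.length_cons] at h ih₁ ih₂
    rw [wordMul, map_add, map_add, map_smul]
    have h₁ : ∃ n : ℕ, coeff (c :: x) (consL k lam a (wordMul k lam u (b :: v))) = n ∧
        (c :: x = a :: u ++ b :: v → 0 < n) := by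
      by_cases hac : a = c
      · subst hac
        obtain ⟨n, hn, hpos⟩ := ih₁ (x := x) (by omega)
        exact ⟨n, by rw [coeff_cons_consL_self, hn], fun h => hpos (by simpa using h)⟩
      · exact ⟨0, by rw [coeff_cons_consL_of_ne hac, Nat.cast_zero],
          fun h => absurd (List.cons.inj h).1.symm hac⟩
    have h₂ : ∃ n : ℕ, coeff (c :: x) (consL k lam b (wordMul k lam (a :: u) v)) = n := by
      by_cases hbc : b = c
      · subst hbc
        obtain ⟨n, hn, -⟩ := ih₂ (x := x) (by omega)
        exact ⟨n, by rw [coeff_cons_consL_self, hn]⟩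
      · exact ⟨0, by rw [coeff_cons_consL_of_ne hbc, Nat.cast_zero]⟩
    -- The weighted term only involves words of smaller length.
    have h₃ : coeff (c :: x) (consL k lam (a * b) (wordMul k lam u v)) = 0 := by
      by_contra hne
      obtain ⟨x', hx, hx'⟩ := exists_of_coeff_consL_ne_zero hne
      obtain rfl := (List.cons.inj hx).2
      rcases length_lt_or_isShuffle hx' with h' | h'
      · omega
      · have := h'.length_eq
        omega
    obtain ⟨n, hn, hpos⟩ := h₁
    obtain ⟨m, hm⟩ := h₂
    exact ⟨n + m, by rw [hn, hm, h₃, smul_zero, add_zero, Nat.cast_add],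
      fun h => Nat.add_pos_left (hpos h) m⟩

theorem coeff_mul_word (p : MixShuffle k lam S) (v x : List S) :
    coeff x (p * word k lam v) = ∑ u ∈ ((wordBasis k lam S).repr p).support,
      coeff u p * coeff x (wordMul k lam u v) := by
  conv_lhs => rw [← sum_coeff_smul_word p, Finset.sum_mul, map_sum]
  refine Finset.sum_congr rfl fun u _ => ?_
  rw [smul_mul_assoc, map_smul, mul_def, mulL_word, smul_eq_mul]

end MixShuffle

end Coefficients

section Precedes

variable {S : Type v} [LinearOrder S]

/-- The strict order on words used for leading terms: `x` precedes `w` if it is shorter, or if it is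
a lexicographically smaller rearrangement of `w`. Restricting the lexicographic comparison to
rearrangements makes this order well-founded over an arbitrary ordered alphabet. -/
def Precedes (x w : List S) : Prop :=
  x.length < w.length ∨ x.Perm w ∧ x < w

theorem Precedes.length_le {x w : List S} (h : Precedes x w) : x.length ≤ w.length :=
  h.elim le_of_lt fun h => h.1.length_eq.le

theorem Precedes.toLex_lt {x w : List S} (h : Precedes x w) :
    toLex (x.length, x) < toLex (w.length, w) := by
  rw [Prod.Lex.toLex_lt_toLex]
  exact h.imp id fun h => ⟨h.1.length_eq, h.2⟩

theorem wellFounded_precedes : WellFounded (Precedes : List S → List S → Prop) := by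
  -- Among the finitely many rearrangements of a word, count the smaller ones.
  let f (w : List S) : ℕ ×ₗ ℕ :=
    toLex (w.length, (w.permutations.toFinset.filter (· < w)).card)
  refine Subrelation.wf (r := InvImage (· < ·) f) ?_ (InvImage.wf f wellFounded_lt)
  rintro x w (h | ⟨hp, h⟩)
  · exact Prod.Lex.toLex_lt_toLex.2 (.inl h)
  · refine Prod.Lex.toLex_lt_toLex.2 (.inr ⟨hp.length_eq, ?_⟩)
    refine Finset.card_lt_card (s := x.permutations.toFinset.filter (· < x))
      (t := w.permutations.toFinset.filter (· < w)) ?_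
    rw [Finset.ssubset_iff_of_subset]
    · exact ⟨x, by simp [hp, h], by simp⟩
    · intro y hy
      simp only [Finset.mem_filter, List.mem_toFinset, List.mem_permutations] at hy ⊢
      exact ⟨hy.1.trans hp, hy.2.trans h⟩

end Precedes

section Leading

variable {k : Type u} [Field k] {lam : k} {S : Type v} [LinearOrder S]

/-- `w` is the leading word of `p`: it occurs in `p`, and all other words of `p` precede it. -/
def HasLeadingWord (p : MixShuffle k lam S) (w : List S) : Prop :=
  MixShuffle.coeff w p ≠ 0 ∧ ∀ x, MixShuffle.coeff x p ≠ 0 → x ≠ w → Precedes x w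

/-- A subspace in which every word is a leading word is everything. -/
theorem eq_top_of_forall_hasLeadingWord {N : Submodule k (MixShuffle k lam S)}
    (h : ∀ w, ∃ p ∈ N, HasLeadingWord p w) : N = ⊤ := by
  have hw : ∀ w, MixShuffle.word k lam w ∈ N := by
    refine fun w => WellFounded.induction (C := fun w => MixShuffle.word k lam w ∈ N)
      wellFounded_precedes w fun w ih => ?_
    obtain ⟨p, hp, hpw, hlt⟩ := h w
    have hsum := MixShuffle.sum_coeff_smul_word p
    rw [← Finset.add_sum_erase _ _ (MixShuffle.mem_support_repr.2 hpw), ← eq_sub_iff_add_eq] at hsum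
    refine (N.smul_mem_iff hpw).1 ?_
    rw [hsum]
    refine N.sub_mem hp (N.sum_mem fun x hx => N.smul_mem _ (ih x ?_))
    obtain ⟨hxw, hx⟩ := Finset.mem_erase.1 hx
    exact hlt x (MixShuffle.mem_support_repr.1 hx) hxw
  refine eq_top_iff.2 fun p _ => ?_
  rw [← MixShuffle.sum_coeff_smul_word p]
  exact N.sum_mem fun x _ => N.smul_mem _ (hw x)

/-- Elements with distinct leading words are linearly independent. -/
theorem linearIndependent_of_hasLeadingWord {ι : Type w} {b : ι → MixShuffle k lam S}
    {f : ι → List S} (hf : Function.Injective f) (h : ∀ i, HasLeadingWord (b i) (f i)) :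
    LinearIndependent k b := by
  classical
  rw [linearIndependent_iff']
  intro s g hg i hi
  by_contra hgi
  obtain ⟨m, hm, hmax⟩ := Finset.exists_max_image (s.filter (g · ≠ 0))
    (fun i => toLex ((f i).length, f i)) ⟨i, by simp [hi, hgi]⟩
  obtain ⟨hms, hgm⟩ := Finset.mem_filter.1 hm
  have hc := congrArg (MixShuffle.coeff (f m)) hg
  rw [map_sum, map_zero, Finset.sum_eq_single_of_mem m hms, map_smul, smul_eq_mul] at hc
  · exact mul_ne_zero hgm (h m).1 hc
  · intro j hj hjm
    rw [map_smul, smul_eq_mul, mul_eq_zero]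
    by_contra! hne
    exact absurd (hmax j (Finset.mem_filter.2 ⟨hj, hne.1⟩))
      (not_le.2 ((h j).2 _ hne.2 (hf.ne hjm.symm)).toLex_lt)

variable [CommSemigroup S]

theorem eq_or_precedes_append {w v x : List S} (hv : ∀ s, s ≠ [] → s <:+ w → v ≤ s)
    (h : MixShuffle.coeff x (MixShuffle.wordMul k lam w v) ≠ 0) :
    x = w ++ v ∨ Precedes x (w ++ v) := by
  rcases MixShuffle.length_lt_or_isShuffle h with h | h
  · exact .inr (.inl (by simpa using h))
  · rcases (h.le_append hv).eq_or_lt with heq | hlt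
    · exact .inl heq
    · exact .inr (.inr ⟨h.perm, hlt⟩)

theorem Precedes.append {u w v x : List S} (hv : ∀ s, s ≠ [] → s <:+ w → v ≤ s)
    (hu : Precedes u w) (h : MixShuffle.coeff x (MixShuffle.wordMul k lam u v) ≠ 0) :
    Precedes x (w ++ v) := by
  rcases MixShuffle.length_lt_or_isShuffle h with h | h
  · have := hu.length_le
    exact .inl (by simp only [List.length_append]; omega)
  · rcases hu with hu | ⟨hp, hlt⟩
    · have := h.length_eq
      exact .inl (by simp only [List.length_append]; omega)
    · obtain ⟨x', hx', hxx'⟩ := h.exists_lt_of_lt hp.length_eq hlt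
      exact .inr ⟨h.perm.trans (hp.append_right v), hxx'.trans_le (hx'.le_append hv)⟩

theorem HasLeadingWord.mul_word [CharZero k] {p : MixShuffle k lam S} {w v : List S}
    (hp : HasLeadingWord p w) (hv : ∀ s, s ≠ [] → s <:+ w → v ≤ s) :
    HasLeadingWord (p * MixShuffle.word k lam v) (w ++ v) := by
  constructor
  · rw [MixShuffle.coeff_mul_word,
      Finset.sum_eq_single_of_mem w (MixShuffle.mem_support_repr.2 hp.1)]
    · obtain ⟨n, hn, hpos⟩ := MixShuffle.exists_coeff_wordMul_eq_natCast (k := k) (lam := lam)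
        (u := w) (v := v) (x := w ++ v) (by simp)
      rw [hn]
      exact mul_ne_zero hp.1 (Nat.cast_ne_zero.2 (hpos rfl).ne')
    · intro u hu huw
      rw [mul_eq_zero]
      by_contra! hne
      exact lt_irrefl _ ((hp.2 u hne.1 huw).append hv hne.2).toLex_lt
  · intro x hx hxw
    rw [MixShuffle.coeff_mul_word] at hx
    obtain ⟨u, -, hu⟩ := Finset.exists_ne_zero_of_sum_ne_zero hx
    by_cases huw : u = w
    · subst huw
      exact (eq_or_precedes_append hv (right_ne_zero_of_mul hu)).resolve_left hxw
    · exact (hp.2 u (left_ne_zero_of_mul hu) huw).append hv (right_ne_zero_of_mul hu)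

/-- The product of a non-increasing sequence of Lyndon words has their concatenation as its leading
word. -/
theorem hasLeadingWord_prod [CharZero k] {L : List (Lyn S)} (hL : L.Pairwise (· ≥ ·)) :
    HasLeadingWord (L.map fun l => MixShuffle.word k lam l.1).prod (concat L) := by
  induction L using List.reverseRecOn with
  | nil =>
    rw [List.map_nil, List.prod_nil, MixShuffle.one_def, concat_nil]
    refine ⟨by rw [MixShuffle.coeff_word_self]; exact one_ne_zero, fun x hx hne => ?_⟩
    exact absurd (MixShuffle.coeff_word_of_ne hne.symm) hx
  | append_singleton L l ih =>
    rw [List.pairwise_append] at hL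
    rw [List.map_append, List.prod_append, concat_append]
    simp only [List.map_cons, List.map_nil, List.prod_cons, List.prod_nil, mul_one, concat_cons,
      concat_nil, List.append_nil]
    exact (ih hL.1).mul_word fun s hs h =>
      le_of_suffix_concat (fun a ha => hL.2.2 a ha l (by simp)) hs h

end Leading

/-! ### The mixable shuffle algebra is a polynomial algebra -/

section Radford

variable {S : Type v} [LinearOrder S]

/-- The word of a monomial in the Lyndon words: the concatenation of its factors in non-increasing
order. -/
def monomialWord (d : Lyn S →₀ ℕ) : List S :=
  concat ((Finsupp.toMultiset d).sort (· ≥ ·))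

theorem monomialWord_injective : Function.Injective (monomialWord (S := S)) := by
  intro d e h
  have := eq_of_concat_eq (Multiset.pairwise_sort _ _) (Multiset.pairwise_sort _ _) h
  apply Multiset.toFinsupp.symm.injective
  change Finsupp.toMultiset d = Finsupp.toMultiset e
  rw [← Multiset.sort_eq (Finsupp.toMultiset d) (· ≥ ·), this, Multiset.sort_eq]

theorem monomialWord_surjective : Function.Surjective (monomialWord (S := S)) := by
  intro w
  obtain ⟨L, hL, rfl⟩ := exists_concat_eq w
  refine ⟨Multiset.toFinsupp (L : Multiset (Lyn S)), ?_⟩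
  rw [monomialWord, Multiset.toFinsupp_toMultiset, Multiset.coe_sort,
    List.mergeSort_eq_self _ (by simpa using hL)]

variable {k : Type u} [Field k] [CharZero k] {lam : k} [CommSemigroup S]

theorem hasLeadingWord_lynMap_monomial (d : Lyn S →₀ ℕ) :
    HasLeadingWord (lynMap k lam S (MvPolynomial.monomial d 1)) (monomialWord d) := by
  have h : lynMap k lam S (MvPolynomial.monomial d 1)
      = (((Finsupp.toMultiset d).sort (· ≥ ·)).map fun l => MixShuffle.word k lam l.1).prod := by
    rw [lynMap, MvPolynomial.aeval_monomial, map_one, one_mul, ← Multiset.prod_coe,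
      ← Multiset.map_coe, Multiset.sort_eq, Finsupp.toMultiset_map, Finsupp.prod_toMultiset,
      Finsupp.prod_mapDomain_index (fun _ => pow_zero _) (fun _ _ _ => pow_add _ _ _)]
  rw [h]
  exact hasLeadingWord_prod (Multiset.pairwise_sort _ _)

variable (k lam S) in
/-- Radford's theorem for the mixable shuffle product of any weight: in characteristic zero the
Lyndon words are free polynomial generators. -/
theorem bijective_lynMap : Function.Bijective (lynMap k lam S) := by
  constructor
  · have hli := linearIndependent_of_hasLeadingWord monomialWord_injective
      (hasLeadingWord_lynMap_monomial (k := k) (lam := lam) (S := S))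
    have h : (lynMap k lam S : MvPolynomial (Lyn S) k → MixShuffle k lam S)
        = Finsupp.linearCombination k (fun d => lynMap k lam S (MvPolynomial.monomial d 1)) ∘
          (MvPolynomial.basisMonomials (Lyn S) k).repr := by
      ext p
      conv_lhs => rw [← (MvPolynomial.basisMonomials (Lyn S) k).linearCombination_repr p]
      rw [Finsupp.linearCombination_apply, Finsupp.sum, map_sum]
      simp [Finsupp.linearCombination_apply, Finsupp.sum]
    rw [h]
    exact Function.Injective.comp hli (MvPolynomial.basisMonomials (Lyn S) k).repr.injective
  · rw [← AlgHom.coe_toLinearMap, ← LinearMap.range_eq_top]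
    refine eq_top_of_forall_hasLeadingWord fun w => ?_
    obtain ⟨d, rfl⟩ := monomialWord_surjective w
    exact ⟨_, ⟨_, rfl⟩, hasLeadingWord_lynMap_monomial d⟩

end Radford

/-! ### The universal property -/

section Universal

variable {k : Type u} [CommRing k] {lam : k}

namespace Sha

variable {S : Type v} [CommMonoid S]

@[simp]
theorem prepend_of (s : S) (x : MixShuffle k lam S) :
    prepend k lam S (MonoidAlgebra.of k S s) x = MixShuffle.consL k lam s x := by
  simp [prepend]

theorem rbOp_tmul (a : MonoidAlgebra k S) (x : MixShuffle k lam S) :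
    rbOp k lam S (a ⊗ₜ x) = 1 ⊗ₜ prepend k lam S a x := rfl

theorem prepend_mul_prepend (a b : MonoidAlgebra k S) (x y : MixShuffle k lam S) :
    prepend k lam S a x * prepend k lam S b y
      = prepend k lam S a (x * prepend k lam S b y) + prepend k lam S b (prepend k lam S a x * y)
        + lam • prepend k lam S (a * b) (x * y) := by
  induction a using MonoidAlgebra.induction_on with
  | of s =>
    induction b using MonoidAlgebra.induction_on with
    | of t =>
      rw [← map_mul, prepend_of, prepend_of, prepend_of, prepend_of, prepend_of]
      exact MixShuffle.consL_mulL_consL s t x y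
    | add b c hb hc =>
      simp only [map_add, LinearMap.add_apply, mul_add, hb, hc, smul_add]; abel
    | smul r b hb =>
      simp only [map_smul, LinearMap.smul_apply, mul_smul_comm, hb, smul_add, smul_comm r lam]
  | add b c hb hc =>
    simp only [map_add, LinearMap.add_apply, add_mul, hb, hc, smul_add]; abel
  | smul r b hb =>
    simp only [map_smul, LinearMap.smul_apply, smul_mul_assoc, hb, smul_add, smul_comm r lam]

theorem isRotaBaxter_rbOp : IsRotaBaxter lam (rbOp k lam S) := by
  intro x y
  induction x using TensorProduct.induction_on with
  | zero => simp
  | add x z hx hz => simp only [map_add, add_mul, hx, hz, smul_add]; abel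
  | tmul a x =>
    induction y using TensorProduct.induction_on with
    | zero => simp
    | add y z hy hz => simp only [map_add, mul_add, hy, hz, smul_add]; abel
    | tmul b y =>
      simp only [rbOp_tmul, Algebra.TensorProduct.tmul_mul_tmul, mul_one, one_mul,
        prepend_mul_prepend, TensorProduct.tmul_add, TensorProduct.tmul_smul]

end Sha

section Lift

variable {S : Type v} {R : Type w} [CommRing R] [Algebra k R]

/-- The value `Q (φ s₁ * Q (φ s₂ * ⋯ Q (φ sₙ)))` of the universal extension on a word. -/
def evalWord (Q : R →ₗ[k] R) (φ : S → R) : List S → R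
  | [] => 1
  | s :: u => Q (φ s * evalWord Q φ u)

variable (lam) in
/-- The linear extension of `evalWord` to the mixable shuffle algebra. -/
def evalL (Q : R →ₗ[k] R) (φ : S → R) : MixShuffle k lam S →ₗ[k] R :=
  (MixShuffle.wordBasis k lam S).constr k (evalWord Q φ)

@[simp]
theorem evalL_word (Q : R →ₗ[k] R) (φ : S → R) (u : List S) :
    evalL lam Q φ (MixShuffle.word k lam u) = evalWord Q φ u := by
  rw [evalL, ← MixShuffle.wordBasis_apply, Module.Basis.constr_basis]

theorem evalL_consL (Q : R →ₗ[k] R) (φ : S → R) (s : S) (x : MixShuffle k lam S) :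
    evalL lam Q φ (MixShuffle.consL k lam s x) = Q (φ s * evalL lam Q φ x) := by
  induction x using MixShuffle.induction_word with
  | hw u => simp [evalWord]
  | hadd x y hx hy => simp only [map_add, hx, hy, mul_add]
  | hsmul c x hx => simp only [map_smul, hx, mul_smul_comm]

theorem evalL_wordMul [CommSemigroup S] {Q : R →ₗ[k] R} (hQ : IsRotaBaxter lam Q) (φ : S →ₙ* R)
    (u v : List S) :
    evalL lam Q φ (MixShuffle.wordMul k lam u v) = evalWord Q φ u * evalWord Q φ v := by
  induction u, v using MixShuffle.wordMul.induct with
  | case1 v => simp [MixShuffle.wordMul, evalWord]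
  | case2 a u => simp [MixShuffle.wordMul, evalWord]
  | case3 a u b v ih₁ ih₂ ih₃ =>
    rw [MixShuffle.wordMul, map_add, map_add, map_smul, evalL_consL, evalL_consL, evalL_consL, ih₁,
      ih₂, ih₃]
    simp only [evalWord]
    rw [hQ, map_mul φ, mul_mul_mul_comm (φ a) _ (φ b), mul_assoc (φ a) _ (Q _),
      mul_left_comm (Q _) (φ b)]

/-- The algebra map from the mixable shuffle algebra to a Rota--Baxter algebra induced by a
multiplicative map of the letters. -/
def evalHom [CommSemigroup S] {Q : R →ₗ[k] R} (hQ : IsRotaBaxter lam Q) (φ : S →ₙ* R) :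
    MixShuffle k lam S →ₐ[k] R :=
  AlgHom.ofLinearMap (evalL lam Q φ) (evalL_word Q φ []) fun x y => by
    induction x using MixShuffle.induction_word with
    | hw u =>
      induction y using MixShuffle.induction_word with
      | hw v =>
        rw [MixShuffle.mul_def, MixShuffle.mulL_word, evalL_wordMul hQ, evalL_word, evalL_word]
      | hadd x y hx hy => simp only [map_add, mul_add, hx, hy]
      | hsmul c x hx => simp only [map_smul, mul_smul_comm, hx]
    | hadd x y hx hy => simp only [map_add, add_mul, hx, hy]
    | hsmul c x hx => simp only [map_smul, smul_mul_assoc, hx]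

theorem evalHom_prepend [CommMonoid S] {Q : R →ₗ[k] R} (hQ : IsRotaBaxter lam Q)
    (φ : MonoidAlgebra k S →ₐ[k] R) (a : MonoidAlgebra k S) (x : MixShuffle k lam S) :
    evalHom hQ ((φ : MonoidAlgebra k S →* R).comp (MonoidAlgebra.of k S) : S →ₙ* R)
        (Sha.prepend k lam S a x)
      = Q (φ a * evalHom hQ ((φ : MonoidAlgebra k S →* R).comp (MonoidAlgebra.of k S) : S →ₙ* R)
          x) := by
  induction a using MonoidAlgebra.induction_on with
  | of s =>
    rw [Sha.prepend_of]
    exact evalL_consL Q _ s x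
  | add a b ha hb => simp only [map_add, LinearMap.add_apply, add_mul, ha, hb]
  | smul r a ha => simp only [map_smul, LinearMap.smul_apply, smul_mul_assoc, ha]

end Lift

/-- The extension of `φ` is `a ⊗ x ↦ φ a * evalHom x`. It is determined by `φ` because
`1 ⊗ (s :: u) = P ((s ⊗ 1) * (1 ⊗ u))`. -/
theorem Sha.isFreeCommRotaBaxter (S : Type v) [CommMonoid S] :
    IsFreeCommRotaBaxter.{u, _, w, _} lam (Sha.rbOp k lam S) (Sha.incl k lam S) := by
  refine ⟨Sha.isRotaBaxter_rbOp, fun R _ _ Q hQ φ => ?_⟩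
  set θ := evalHom hQ ((φ : MonoidAlgebra k S →* R).comp (MonoidAlgebra.of k S) : S →ₙ* R)
  refine ⟨Algebra.TensorProduct.lift φ θ fun _ _ => .all _ _, ⟨fun x => ?_, fun a => ?_⟩, ?_⟩
  · induction x using TensorProduct.induction_on with
    | zero => simp
    | add x y hx hy => simp only [map_add, hx, hy]
    | tmul a x =>
      rw [Sha.rbOp_tmul, Algebra.TensorProduct.lift_tmul, Algebra.TensorProduct.lift_tmul, map_one,
        one_mul]
      exact evalHom_prepend hQ φ a x
  · simp [Sha.incl]
  · rintro ψ ⟨hP, hφ⟩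
    apply Algebra.TensorProduct.ext'
    intro a x
    have hx : ψ (1 ⊗ₜ x) = θ x := by
      induction x using MixShuffle.induction_word with
      | hadd x y hx hy => rw [TensorProduct.tmul_add, map_add, map_add, hx, hy]
      | hsmul c x hx => rw [TensorProduct.tmul_smul, map_smul, map_smul, hx]
      | hw u =>
        induction u with
        | nil => rw [← MixShuffle.one_def, map_one]; exact map_one ψ
        | cons s u ih =>
          have h1 : (1 : MonoidAlgebra k S) ⊗ₜ[k] MixShuffle.word k lam (s :: u)
              = Sha.rbOp k lam S (Sha.incl k lam S (MonoidAlgebra.of k S s)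
                  * 1 ⊗ₜ MixShuffle.word k lam u) := by
            rw [Sha.incl, Algebra.TensorProduct.includeLeft_apply,
              Algebra.TensorProduct.tmul_mul_tmul, mul_one, one_mul, Sha.rbOp_tmul, Sha.prepend_of,
              MixShuffle.consL_word]
          rw [h1, hP, map_mul, hφ, ih, ← MixShuffle.consL_word, ← Sha.prepend_of]
          exact (evalHom_prepend hQ φ _ _).symm
    have hax : a ⊗ₜ[k] x = Sha.incl k lam S a * 1 ⊗ₜ x := by
      simp [Sha.incl]
    rw [hax, map_mul, hφ, hx, ← hax, Algebra.TensorProduct.lift_tmul]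

/-- Being free is insensitive to precomposing the structure map with an isomorphism. -/
theorem IsFreeCommRotaBaxter.comp_equiv {A : Type v} [CommRing A] [Algebra k A] {B : Type v}
    [CommRing B] [Algebra k B] {F : Type t} [CommRing F] [Algebra k F] {P : F →ₗ[k] F}
    {j : A →ₐ[k] F} (h : IsFreeCommRotaBaxter.{u, v, w, t} lam P j) (e : B ≃ₐ[k] A) :
    IsFreeCommRotaBaxter.{u, v, w, t} lam P (j.comp (e : B →ₐ[k] A)) := by
  refine ⟨h.1, fun R _ _ Q hQ φ => ?_⟩
  obtain ⟨ψ, ⟨hψ, hψφ⟩, huniq⟩ := h.2 R Q hQ (φ.comp (e.symm : A →ₐ[k] B))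
  refine ⟨ψ, ⟨hψ, fun b => ?_⟩, fun ψ' hψ' => huniq ψ' ⟨hψ'.1, fun a => ?_⟩⟩
  · simpa using hψφ (e b)
  · simpa using hψ'.2 (e.symm a)

end Universal

/-! ### Polynomial generators -/

section Generators

variable (k : Type u) [CommRing k] (lam : k) (X : Type v)

/-- The polynomial algebra on `X` is the monoid algebra of the free commutative monoid on `X`. -/
def polyEquiv : MvPolynomial X k ≃ₐ[k] MonoidAlgebra k (FreeCommMon X) :=
  AddMonoidAlgebra.toMultiplicativeAlgEquiv k k (X →₀ ℕ)

variable {X} in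
theorem polyEquiv_X (x : X) :
    polyEquiv k X (MvPolynomial.X x)
      = MonoidAlgebra.of k (FreeCommMon X) (FreeCommMon.of x) :=
  AddMonoidAlgebra.toMultiplicativeAlgEquiv_single ..

theorem polyIncl_eq :
    polyIncl k lam X = (Sha.incl k lam (FreeCommMon X)).comp
      (polyEquiv k X : MvPolynomial X k →ₐ[k] MonoidAlgebra k (FreeCommMon X)) := by
  ext x
  simp [polyIncl, varElt, polyEquiv_X]

theorem aeval_lynBar_comp_tensorEquivSum [LinearOrder (FreeCommMon X)] :
    (MvPolynomial.aeval (lynBar k lam X)).comp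
        (MvPolynomial.tensorEquivSum k X (Lyn (FreeCommMon X)) k).toAlgHom
      = (tensorLynMap k lam (FreeCommMon X)).comp
          (Algebra.TensorProduct.congr (polyEquiv k X) AlgEquiv.refl).toAlgHom := by
  ext x
  · simp [lynBar, tensorLynMap, varElt, Sha.incl, polyEquiv_X]
  · simp [lynBar, tensorLynMap, lynMap]

variable {lam}

theorem bijective_tensorLynMap (S : Type v) [CommMonoid S] [LinearOrder S]
    (h : Function.Bijective (lynMap k lam S)) : Function.Bijective (tensorLynMap k lam S) :=
  (Algebra.TensorProduct.congr (AlgEquiv.refl : MonoidAlgebra k S ≃ₐ[k] MonoidAlgebra k S)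
    (AlgEquiv.ofBijective _ h)).bijective

theorem bijective_aeval_lynBar [LinearOrder (FreeCommMon X)]
    (h : Function.Bijective (tensorLynMap k lam (FreeCommMon X))) :
    Function.Bijective (MvPolynomial.aeval (lynBar k lam X) :
      MvPolynomial (X ⊕ Lyn (FreeCommMon X)) k →ₐ[k] Sha k lam (FreeCommMon X)) := by
  have h1 := h.comp (Algebra.TensorProduct.congr (polyEquiv k X)
    (AlgEquiv.refl : MvPolynomial (Lyn (FreeCommMon X)) k ≃ₐ[k] _)).bijective
  refine (Function.Bijective.of_comp_iff _
    (MvPolynomial.tensorEquivSum k X (Lyn (FreeCommMon X)) k).bijective).1 ?_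
  convert h1 using 1
  ext x
  exact DFunLike.congr_fun (aeval_lynBar_comp_tensorEquivSum k lam X) x

end Generators

end RotaBaxter

end

theorem mainTheorem7 (lam : ℚ) :
    (∀ (S : Type u) [CommMonoid S] [LinearOrder S],
      RotaBaxter.IsFreeCommRotaBaxter.{0, _, w, _} lam (RotaBaxter.Sha.rbOp ℚ lam S)
          (RotaBaxter.Sha.incl ℚ lam S) ∧
        Function.Bijective (RotaBaxter.tensorLynMap ℚ lam S)) ∧
    (∀ (X : Type v) [LinearOrder (RotaBaxter.FreeCommMon X)],
      RotaBaxter.IsFreeCommRotaBaxter.{0, _, w, _} lam (RotaBaxter.Sha.rbOp ℚ lam (RotaBaxter.FreeCommMon X))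
          (RotaBaxter.polyIncl ℚ lam X) ∧
        Function.Bijective
          (MvPolynomial.aeval (RotaBaxter.lynBar ℚ lam X) :
            MvPolynomial (X ⊕ RotaBaxter.Lyn (RotaBaxter.FreeCommMon X)) ℚ →ₐ[ℚ]
              RotaBaxter.Sha ℚ lam (RotaBaxter.FreeCommMon X))) := by
  refine ⟨fun S _ _ => ⟨RotaBaxter.Sha.isFreeCommRotaBaxter S,
    RotaBaxter.bijective_tensorLynMap ℚ S (RotaBaxter.bijective_lynMap S ℚ lam)⟩,
    fun X _ => ⟨?_, ?_⟩⟩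
  · rw [RotaBaxter.polyIncl_eq]
    exact (RotaBaxter.Sha.isFreeCommRotaBaxter (RotaBaxter.FreeCommMon X)).comp_equiv
      (RotaBaxter.polyEquiv ℚ X)
  · exact RotaBaxter.bijective_aeval_lynBar ℚ X
      (RotaBaxter.bijective_tensorLynMap ℚ _ (RotaBaxter.bijective_lynMap _ ℚ lam))
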